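/- Let $T$ be the right-shift operator $T(x_0,x_1,x_2,\dots)=(0,x_0,x_1,x_2,\dots)$ on the real space $\ell^1(\mathbb N)$ with the norm $\|x\|_1=\sum_{i\ge 0}|x_i|$; this linear operator is nonexpansive, that is, $\|Tx-Ty\|_1\le\|x-y\|_1$ for all $x,y\in\ell^1(\mathbb N)$. Let $(\alpha_n)_{n\ge 0}$ be an arbitrary sequence of stepsizes in $[0,1]$, and let $(x^n)_{n\ge 0}$ be the iterates of the Krasnosel'skiĭ–Mann iteration $$x^n=(1-\alpha_n)\,x^{n-1}+\alpha_n\,Tx^{n-1}\qquad(n\ge 1)$$ started from $x^0=(1,0,0,\dots)$. Then $$\|x^n-Tx^n\|_1\ \ge\ \frac{1}{\sqrt{n+1}}\qquad\text{for all } n\ge 0.$$ In particular, the residual $\|x^n-Tx^n\|_1$ cannot decay faster than $1/\sqrt n$, whatever the stepsizes: $1/\sqrt n=O(\|x^n-Tx^n\|_1)$ as $n\to\infty$. -/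

import Mathlib

open scoped ENNReal

/-- The real Banach space `ℓ¹(ℕ)` with the norm `‖x‖₁ = ∑ |x i|`. -/
abbrev EllOne : Type := lp (fun _ : ℕ => ℝ) 1

/-- The right shift of a sequence: `(x₀, x₁, x₂, …) ↦ (0, x₀, x₁, x₂, …)`. -/
def shiftSeq (x : ℕ → ℝ) : ℕ → ℝ
  | 0 => 0
  | k + 1 => x k

theorem memlp_shiftSeq {x : ℕ → ℝ} (hx : Memℓp x 1) : Memℓp (shiftSeq x) 1 := by
  have h1 : 0 < (1 : ℝ≥0∞).toReal := by norm_num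
  refine memℓp_gen ?_
  have h : Summable fun i => ‖x i‖ ^ (1 : ℝ≥0∞).toReal := hx.summable h1
  exact (summable_nat_add_iff 1).1 h

/-- The right-shift linear operator on `ℓ¹(ℕ)`. -/
def rightShift : EllOne →ₗ[ℝ] EllOne where
  toFun x := ⟨shiftSeq (fun i => x i), memlp_shiftSeq (lp.memℓp x)⟩
  map_add' x y := by
    apply lp.ext
    funext k
    cases k with
    | zero => exact (add_zero (0 : ℝ)).symm
    | succ k => rfl
  map_smul' c x := by
    apply lp.ext
    funext k
    cases k with
    | zero => exact (mul_zero c).symm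
    | succ k => rfl

/-- The Krasnosel'skii-Mann iterates of a map `T`, started at `x₀`, with stepsizes `α 1, α 2, …`:
`x⁰ = x₀` and `xⁿ = (1 - α n) xⁿ⁻¹ + α n • T xⁿ⁻¹` for `n ≥ 1`. -/
def kmIterate {X : Type*} [AddCommGroup X] [Module ℝ X] (T : X → X) (α : ℕ → ℝ) (x₀ : X) : ℕ → X
  | 0 => x₀
  | n + 1 => (1 - α (n + 1)) • kmIterate T α x₀ n + α (n + 1) • T (kmIterate T α x₀ n)

theorem EllOne.summable_norm (x : EllOne) : Summable fun k => ‖x k‖ := by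
  simpa using (lp.memℓp x).summable (by norm_num)

theorem EllOne.norm_eq_tsum (x : EllOne) : ‖x‖ = ∑' k, ‖x k‖ := by
  simpa using lp.norm_eq_tsum_rpow (p := 1) (by norm_num) x

theorem rightShift_apply_zero (x : EllOne) : rightShift x 0 = 0 := rfl

theorem rightShift_apply_succ (x : EllOne) (k : ℕ) : rightShift x (k + 1) = x k := rfl

theorem norm_rightShift (x : EllOne) : ‖rightShift x‖ = ‖x‖ := by
  rw [EllOne.norm_eq_tsum, EllOne.norm_eq_tsum, (EllOne.summable_norm _).tsum_eq_zero_add]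
  simp [rightShift_apply_zero, rightShift_apply_succ]

theorem norm_mul_pow_of_norm_eq_one {z : ℂ} (hz : ‖z‖ = 1) (a : ℝ) (k : ℕ) :
    ‖(a : ℂ) * z ^ k‖ = ‖a‖ := by
  simp [hz]

theorem EllOne.summable_mul_pow {z : ℂ} (hz : ‖z‖ = 1) (x : EllOne) :
    Summable fun k => (x k : ℂ) * z ^ k := by
  refine Summable.of_norm ?_
  simpa only [norm_mul_pow_of_norm_eq_one hz] using x.summable_norm

/-- The generating function `∑ x k * z ^ k` of a summable sequence. -/
noncomputable def EllOne.genFun (z : ℂ) (x : EllOne) : ℂ := ∑' k, (x k : ℂ) * z ^ k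

theorem EllOne.norm_genFun_le {z : ℂ} (hz : ‖z‖ = 1) (x : EllOne) : ‖x.genFun z‖ ≤ ‖x‖ := by
  have h := norm_tsum_le_tsum_norm (x.summable_mul_pow hz).norm
  simpa only [norm_mul_pow_of_norm_eq_one hz, ← EllOne.norm_eq_tsum, EllOne.genFun] using h

theorem EllOne.genFun_add {z : ℂ} (hz : ‖z‖ = 1) (x y : EllOne) :
    (x + y).genFun z = x.genFun z + y.genFun z := by
  unfold EllOne.genFun
  rw [← (x.summable_mul_pow hz).tsum_add (y.summable_mul_pow hz)]
  simp [add_mul]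

theorem EllOne.genFun_smul (z : ℂ) (c : ℝ) (x : EllOne) :
    (c • x).genFun z = c * x.genFun z := by
  unfold EllOne.genFun
  rw [← tsum_mul_left]
  simp [mul_assoc]

theorem EllOne.genFun_rightShift {z : ℂ} (hz : ‖z‖ = 1) (x : EllOne) :
    (rightShift x).genFun z = z * x.genFun z := by
  unfold EllOne.genFun
  rw [((rightShift x).summable_mul_pow hz).tsum_eq_zero_add, ← tsum_mul_left]
  simp only [rightShift_apply_zero, rightShift_apply_succ, Complex.ofReal_zero, zero_mul, zero_add]
  exact tsum_congr fun k => by ring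

theorem EllOne.genFun_single_zero (z : ℂ) :
    EllOne.genFun z (lp.single 1 0 (1 : ℝ)) = 1 := by
  unfold EllOne.genFun
  rw [tsum_eq_single 0]
  · simp
  · intro k hk
    simp [hk]

theorem EllOne.genFun_sub_rightShift {z : ℂ} (hz : ‖z‖ = 1) (x : EllOne) :
    (x - rightShift x).genFun z = (1 - z) * x.genFun z := by
  have h := EllOne.genFun_add hz (x - rightShift x) (rightShift x)
  rw [sub_add_cancel, EllOne.genFun_rightShift hz] at h
  linear_combination -h

/-- The point `1 - 2 s ^ 2 + 2 s √(1 - s ^ 2) i` of the unit circle, at distance `2 s` from `1`. -/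
noncomputable def circlePoint (s : ℝ) : ℂ := ⟨1 - 2 * s ^ 2, 2 * s * Real.sqrt (1 - s ^ 2)⟩

theorem norm_sq_one_sub_add_mul_circlePoint {s : ℝ} (hs : s ^ 2 ≤ 1) (a : ℝ) :
    ‖((1 - a : ℝ) : ℂ) + a * circlePoint s‖ ^ 2 = 1 - 4 * a * (1 - a) * s ^ 2 := by
  have h := Real.sq_sqrt (sub_nonneg.2 hs)
  rw [Complex.sq_norm, Complex.normSq_apply]
  simp only [circlePoint, Complex.add_re, Complex.add_im, Complex.ofReal_re, Complex.ofReal_im,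
    Complex.re_ofReal_mul, Complex.im_ofReal_mul]
  linear_combination 4 * a ^ 2 * s ^ 2 * h

theorem norm_circlePoint {s : ℝ} (hs : s ^ 2 ≤ 1) : ‖circlePoint s‖ = 1 := by
  have h := norm_sq_one_sub_add_mul_circlePoint hs 1
  rw [← sq_eq_sq₀ (norm_nonneg _) zero_le_one]
  simpa using h

theorem norm_sq_one_sub_circlePoint {s : ℝ} (hs : s ^ 2 ≤ 1) :
    ‖1 - circlePoint s‖ ^ 2 = 4 * s ^ 2 := by
  have h := Real.sq_sqrt (sub_nonneg.2 hs)
  rw [Complex.sq_norm, Complex.normSq_apply]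
  simp only [circlePoint, Complex.sub_re, Complex.sub_im, Complex.one_re, Complex.one_im]
  linear_combination 4 * s ^ 2 * h

theorem pow_le_norm_sq_genFun_kmIterate {α : ℕ → ℝ} {s : ℝ} (hs : s ^ 2 ≤ 1) (n : ℕ) :
    (1 - s ^ 2) ^ n ≤
      ‖(kmIterate rightShift α (lp.single 1 0 (1 : ℝ)) n).genFun (circlePoint s)‖ ^ 2 := by
  have hz := norm_circlePoint hs
  induction n with
  | zero => simp [kmIterate, EllOne.genFun_single_zero]
  | succ n ih =>
    rw [kmIterate, EllOne.genFun_add hz, EllOne.genFun_smul, EllOne.genFun_smul,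
      EllOne.genFun_rightShift hz, ← mul_assoc, ← add_mul, norm_mul, mul_pow,
      norm_sq_one_sub_add_mul_circlePoint hs, pow_succ']
    have h : 1 - s ^ 2 ≤ 1 - 4 * α (n + 1) * (1 - α (n + 1)) * s ^ 2 := by
      linarith [mul_nonneg (sq_nonneg (2 * α (n + 1) - 1)) (sq_nonneg s)]
    exact mul_le_mul h ih (pow_nonneg (sub_nonneg.2 hs) n) ((sub_nonneg.2 hs).trans h)

theorem one_fourth_le_one_sub_one_div_pow (n : ℕ) :
    (1 / 4 : ℝ) ≤ (1 - 1 / ((n : ℝ) + 1)) ^ n := by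
  rcases Nat.eq_zero_or_pos n with rfl | hn
  · norm_num
  have hn' : (0 : ℝ) < n := Nat.cast_pos.2 hn
  have h : (1 + 1 / (n : ℝ)) ^ n ≤ 4 := by
    calc (1 + 1 / (n : ℝ)) ^ n ≤ Real.exp (1 / n) ^ n := by
          gcongr
          linarith [Real.add_one_le_exp (1 / (n : ℝ))]
      _ = Real.exp 1 := by
          rw [← Real.exp_nat_mul, mul_one_div_cancel hn'.ne']
      _ ≤ 4 := by linarith [Real.exp_one_lt_d9]
  have e : 1 - 1 / ((n : ℝ) + 1) = (1 + 1 / (n : ℝ))⁻¹ := by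
    field_simp
    ring
  rw [e, inv_pow, one_div]
  exact inv_anti₀ (by positivity) h

theorem one_div_sqrt_le_norm_kmIterate_sub (α : ℕ → ℝ) (n : ℕ) :
    1 / Real.sqrt ((n : ℝ) + 1) ≤
      ‖kmIterate rightShift α (lp.single 1 0 (1 : ℝ)) n -
        rightShift (kmIterate rightShift α (lp.single 1 0 (1 : ℝ)) n)‖ := by
  have hn : (0 : ℝ) < (n : ℝ) + 1 := by positivity
  set s : ℝ := 1 / Real.sqrt ((n : ℝ) + 1) with hs_def
  have hs : s ^ 2 = 1 / ((n : ℝ) + 1) := by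
    rw [hs_def, div_pow, Real.sq_sqrt hn.le, one_pow]
  have hs1 : s ^ 2 ≤ 1 := by
    rw [hs, div_le_one hn]
    linarith [(Nat.cast_nonneg n : (0 : ℝ) ≤ n)]
  refine le_trans ?_ (EllOne.norm_genFun_le (norm_circlePoint hs1) _)
  refine le_of_sq_le_sq ?_ (norm_nonneg _)
  rw [EllOne.genFun_sub_rightShift (norm_circlePoint hs1), norm_mul, mul_pow,
    norm_sq_one_sub_circlePoint hs1]
  have h : 1 / 4 ≤ (1 - s ^ 2) ^ n := hs ▸ one_fourth_le_one_sub_one_div_pow n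
  have h' := mul_le_mul_of_nonneg_left
    (h.trans (pow_le_norm_sq_genFun_kmIterate (α := α) hs1 n)) (mul_nonneg zero_le_four (sq_nonneg s))
  linarith

theorem one_div_sqrt_le_two_mul_one_div_sqrt_add_one (n : ℕ) :
    1 / Real.sqrt (n : ℝ) ≤ 2 * (1 / Real.sqrt ((n : ℝ) + 1)) := by
  rcases Nat.eq_zero_or_pos n with rfl | hn
  · simp
  have hn' : (1 : ℝ) ≤ n := Nat.one_le_cast.2 hn
  have h : Real.sqrt ((n : ℝ) + 1) ≤ 2 * Real.sqrt n := by
    rw [Real.sqrt_le_left (by positivity), mul_pow, Real.sq_sqrt (by positivity)]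
    linarith
  rw [mul_one_div, div_le_div_iff₀ (by positivity) (by positivity), one_mul]
  exact h

theorem proposition4 :
    (∀ x y : EllOne, ‖rightShift x - rightShift y‖ ≤ ‖x - y‖) ∧
    ∀ α : ℕ → ℝ, (∀ n, α n ∈ Set.Icc (0 : ℝ) 1) →
      ∀ x : ℕ → EllOne, x = kmIterate rightShift α (lp.single 1 0 (1 : ℝ)) →
        (∀ n : ℕ, 1 / Real.sqrt ((n : ℝ) + 1) ≤ ‖x n - rightShift (x n)‖) ∧
        (fun n : ℕ => 1 / Real.sqrt (n : ℝ)) =O[Filter.atTop]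
          (fun n : ℕ => ‖x n - rightShift (x n)‖) := by
  refine ⟨fun x y => by rw [← map_sub, norm_rightShift], ?_⟩
  rintro α - x rfl
  refine ⟨one_div_sqrt_le_norm_kmIterate_sub α, Asymptotics.IsBigO.of_bound 2 ?_⟩
  refine Filter.Eventually.of_forall fun n => ?_
  rw [norm_norm, Real.norm_of_nonneg (by positivity)]
  exact (one_div_sqrt_le_two_mul_one_div_sqrt_add_one n).trans
    (mul_le_mul_of_nonneg_left (one_div_sqrt_le_norm_kmIterate_sub α n) zero_le_two)
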